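/- Let $f:\mathbb R^n\to\mathbb R$ be continuously differentiable with locally Lipschitz gradient, let $x^\star$ be its unique minimizer, $f^\star=f(x^\star)$, and suppose that $f$ satisfies the Polyak–Łojasiewicz inequality $\tfrac12\|\nabla f(x)\|^2\ge\mu\,(f(x)-f^\star)$ for all $x\in\mathbb R^n$, with some $\mu>0$. Let $c_1,c_2>0$, $p_1>2$ and $p_2\in(1,2)$ satisfy $$2+\frac1{p_1-2}=\frac1{2-p_2},$$ and put $$p=c_1(2\mu)^{\frac{p_1}{2(p_1-1)}},\qquad q=c_2(2\mu)^{\frac{p_2}{2(p_2-1)}},\qquad \xi=\frac{2p_1-2}{p_1-2}.$$ For $\eta>0$ consider the forward-Euler iteration started at $x_0\in\mathbb R^n$, $$x_{k+1}=x_k-\eta c_1\frac{\nabla f(x_k)}{\|\nabla f(x_k)\|^{\frac{p_1-2}{p_1-1}}}-\eta c_2\frac{\nabla f(x_k)}{\|\nabla f(x_k)\|^{\frac{p_2-2}{p_2-1}}},$$ where $x_{k+1}=x_k$ if $\nabla f(x_k)=0$. Then for every $x_0\in\mathbb R^n$ and every $\epsilon>0$ there is $\eta^*>0$ such that for all $\eta\in(0,\eta^*]$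 the iterates satisfy $$\|x_k-x^\star\|\le\begin{cases}\sqrt{\dfrac2\mu}\left(\sqrt{\dfrac pq}\,\tan\!\left(\dfrac\pi2-\dfrac{\sqrt{pq}}{\xi}\,\eta k\right)\right)^{\xi/2}+\epsilon, & 1\le k\le k^*,\\[2ex] \epsilon, & k>k^*,\end{cases}\qquad k^*=\left\lceil\frac{\xi\pi}{2\eta\sqrt{pq}}\right\rceil .$$ (Here the tangent is replaced by $0$ if its argument is negative, which can happen only for $k=k^*$; at $k=0$ the tangent is $+\infty$ and nothing is claimed.) -/

import Mathlib

noncomputable section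

/-- `f : ℝⁿ → ℝ` is `C¹` with locally Lipschitz gradient, attains its minimum at the unique
minimizer `xs`, and satisfies the Polyak-Lojasiewicz inequality with constant `μ > 0`. -/
structure PLFunction {n : ℕ} (f : EuclideanSpace ℝ (Fin n) → ℝ)
    (xs : EuclideanSpace ℝ (Fin n)) (μ : ℝ) : Prop where
  contDiff : ContDiff ℝ 1 f
  locallyLipschitz_gradient : LocallyLipschitz (gradient f)
  isMin : ∀ x, f xs ≤ f x
  unique_min : ∀ y, (∀ x, f y ≤ f x) → y = xs
  mu_pos : 0 < μ
  pl : ∀ x, μ * (f x - f xs) ≤ 1 / 2 * ‖gradient f x‖ ^ 2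

open Classical in
/-- The right-hand side of the fixed-time stable gradient flow. -/
def fxtsField {n : ℕ} (f : EuclideanSpace ℝ (Fin n) → ℝ) (c₁ c₂ p₁ p₂ : ℝ)
    (x : EuclideanSpace ℝ (Fin n)) : EuclideanSpace ℝ (Fin n) :=
  if gradient f x = 0 then 0
  else -(c₁ / ‖gradient f x‖ ^ ((p₁ - 2) / (p₁ - 1))) • gradient f x
    - (c₂ / ‖gradient f x‖ ^ ((p₂ - 2) / (p₂ - 1))) • gradient f x

/-- `x` is the forward-Euler trajectory with step `η` started at `x₀`. -/
def IsEulerTrajectory {n : ℕ} (F : EuclideanSpace ℝ (Fin n) → EuclideanSpace ℝ (Fin n))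
    (η : ℝ) (x₀ : EuclideanSpace ℝ (Fin n)) (x : ℕ → EuclideanSpace ℝ (Fin n)) : Prop :=
  x 0 = x₀ ∧ ∀ k, x (k + 1) = x k + η • F (x k)

/-- The coefficient `c (2μ)^(r / (2 (r - 1)))`; it is `p` for `(c₁, p₁)` and `q` for `(c₂, p₂)`. -/
def decayCoeff (μ c r : ℝ) : ℝ := c * (2 * μ) ^ (r / (2 * (r - 1)))

/-- The exponent parameter `ξ = (2 p₁ - 2) / (p₁ - 2)`. -/
def xiParam (p₁ : ℝ) : ℝ := (2 * p₁ - 2) / (p₁ - 2)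

/-- The switching index `k* = ⌈ξ π / (2 η √(p q))⌉`. -/
def kStar (ξ p q η : ℝ) : ℕ := ⌈ξ * Real.pi / (2 * η * Real.sqrt (p * q))⌉₊

/-- `m^(-1/2) (√(p/q) tan (π/2 - √(p q) t / ξ))^(ξ/2)`, used for `t > 0` (at `t = 0` the tangent
is infinite). The positive part matters only at the last index `k*`, where rounding up can make
the angle slightly negative and the real power meaningless; the expression is then `0`. -/
def tanBound (m ξ p q t : ℝ) : ℝ :=
  1 / Real.sqrt m *
    (Real.sqrt (p / q) * max 0 (Real.tan (Real.pi / 2 - Real.sqrt (p * q) / ξ * t))) ^ (ξ / 2)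

end

/-!
Put `V k = f (x k) - f xs`. The direction field is the negative gradient, rescaled so that its norm
is a sum of two powers of `‖∇ f‖`. The Polyak-Łojasiewicz inequality turns the continuous flow into
`V' ≤ -(p V ^ (1 - 1 / ξ) + q V ^ (1 + 1 / ξ))`, which says that
`arctan (√(q / p) V ^ (1 / ξ))`, a concave function of `V`, decreases with speed at least
`√(p q) / ξ`. By concavity an Euler step of the scalar equation decreases it at least as much as
the flow does, so the only loss is the second-order term of the descent lemma. Outside
`{V ≤ ε₀}` that term costs a factor `1 - δ` of the speed when the step is small. Since the variable
starts at a definite distance below `π / 2`, a small `δ` costs less than this distance over the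
time `ξ π / (2 √(p q))` in question; inside `{V ≤ ε₀}` a single step leads at most to
`{V ≤ 2 ε₀}`. Quadratic growth of `f`, obtained from Ekeland's variational principle, converts the
bounds on `V` into bounds on the distance to the minimizer.
-/

open Filter Metric Real Set Topology
open scoped Gradient NNReal

section Ekeland

variable {X : Type*} [PseudoMetricSpace X] {g : X → ℝ} {m : ℝ}

/-- The points above which `w` lies in the partial order of Ekeland's variational principle for `g`
with slope `m`. -/
def ekelandSet (g : X → ℝ) (m : ℝ) (w : X) : Set X := {z | g z + m * dist w z ≤ g w}

lemma mem_ekelandSet {w z : X} : z ∈ ekelandSet g m w ↔ g z + m * dist w z ≤ g w := Iff.rfl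

lemma self_mem_ekelandSet (w : X) : w ∈ ekelandSet g m w := by simp [mem_ekelandSet]

lemma ekelandSet_subset (hm : 0 ≤ m) {w z : X} (hz : z ∈ ekelandSet g m w) :
    ekelandSet g m z ⊆ ekelandSet g m w := by
  intro z' hz'
  have htri := mul_le_mul_of_nonneg_left (dist_triangle w z z') hm
  rw [mem_ekelandSet] at hz hz' ⊢
  linarith

lemma le_of_mem_ekelandSet (hm : 0 ≤ m) {w z : X} (hz : z ∈ ekelandSet g m w) : g z ≤ g w := by
  have hdist : 0 ≤ m * dist w z := by positivity
  rw [mem_ekelandSet] at hz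
  linarith

lemma isClosed_ekelandSet (hg : LowerSemicontinuous g) (w : X) : IsClosed (ekelandSet g m w) :=
  (hg.add (by fun_prop : Continuous fun z => m * dist w z).lowerSemicontinuous).isClosed_preimage
    (g w)

lemma exists_mem_ekelandSet_forall_le_add (hbdd : BddBelow (range g)) {r : ℝ} (hr : 0 < r)
    (w : X) : ∃ z ∈ ekelandSet g m w, ∀ z' ∈ ekelandSet g m w, g z ≤ g z' + r := by
  have hne : (g '' ekelandSet g m w).Nonempty := ⟨g w, w, self_mem_ekelandSet w, rfl⟩
  obtain ⟨_, ⟨z, hz, rfl⟩, hlt⟩ := exists_lt_of_csInf_lt hne (lt_add_of_pos_right _ hr)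
  refine ⟨z, hz, fun z' hz' => hlt.le.trans ?_⟩
  gcongr
  exact csInf_le (hbdd.mono (image_subset_range _ _)) ⟨z', hz', rfl⟩

lemma exists_tendsto_of_mem_ekelandSet [CompleteSpace X] (hm : 0 < m)
    (hg : LowerSemicontinuous g) (hbdd : BddBelow (range g)) {s : ℕ → X}
    (hs : ∀ n, s (n + 1) ∈ ekelandSet g m (s n)) : ∃ y, ∀ n, y ∈ ekelandSet g m (s n) := by
  have hmem {n k : ℕ} (hnk : n ≤ k) : s k ∈ ekelandSet g m (s n) := by
    induction k, hnk using Nat.le_induction with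
    | base => exact self_mem_ekelandSet _
    | succ k _ ih => exact ekelandSet_subset hm.le ih (hs k)
  have hanti : Antitone fun n => g (s n) := fun _ _ hnk => le_of_mem_ekelandSet hm.le (hmem hnk)
  have hbdd' : BddBelow (range fun n => g (s n)) := hbdd.mono (range_comp_subset_range s g)
  have hcauchy : CauchySeq s := by
    refine cauchySeq_of_le_tendsto_0' (fun n => (g (s n) - ⨅ k, g (s k)) / m)
      (fun n k hnk => ?_) ?_
    · rw [le_div_iff₀' hm]
      linarith [ciInf_le hbdd' k, mem_ekelandSet.1 (hmem hnk)]
    · simpa using ((tendsto_atTop_ciInf hanti hbdd').sub_const (⨅ k, g (s k))).div_const m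
  obtain ⟨y, hy⟩ := cauchySeq_tendsto_of_complete hcauchy
  exact ⟨y, fun n => (isClosed_ekelandSet hg _).mem_of_tendsto hy
    ((eventually_ge_atTop n).mono fun _ hnk => hmem hnk)⟩

theorem exists_forall_le_add_mul_dist [CompleteSpace X] (hm : 0 < m)
    (hg : LowerSemicontinuous g) (hbdd : BddBelow (range g)) (x : X) :
    ∃ y, g y + m * dist x y ≤ g x ∧ ∀ z, g y ≤ g z + m * dist y z := by
  choose next hnext hmin using fun n : ℕ =>
    exists_mem_ekelandSet_forall_le_add (m := m) hbdd (Nat.one_div_pos_of_nat (α := ℝ) (n := n))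
  let s : ℕ → X := fun n => n.rec x next
  obtain ⟨y, hy⟩ := exists_tendsto_of_mem_ekelandSet hm hg hbdd (s := s) fun n => hnext n (s n)
  refine ⟨y, hy 0, fun z => ?_⟩
  by_contra! hz
  have hle (n : ℕ) : g y ≤ g z + 1 / ((n : ℝ) + 1) :=
    (le_of_mem_ekelandSet hm.le (hy (n + 1))).trans
      (hmin n (s n) z (ekelandSet_subset hm.le (hy n) hz.le))
  have hlim : g y ≤ g z := by
    simpa using ge_of_tendsto' (tendsto_one_div_add_atTop_nhds_zero_nat.const_add (g z)) hle
  have hdist : 0 ≤ m * dist y z := by positivity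
  linarith

end Ekeland

lemma norm_fderiv_le_of_eventually_le_add {E : Type*} [NormedAddCommGroup E] [NormedSpace ℝ E]
    {f : E → ℝ} {f' : E →L[ℝ] ℝ} {x : E} {m : ℝ} (hf : HasFDerivAt f f' x) (hm : 0 ≤ m)
    (hle : ∀ᶠ z in 𝓝 x, f x ≤ f z + m * dist x z) : ‖f'‖ ≤ m := by
  have hdir (v : E) : -(m * ‖v‖) ≤ f' v := by
    have hline : Tendsto (fun t : ℝ => x + t • v) (𝓝[>] 0) (𝓝 x) :=
      ((by fun_prop : Continuous fun t : ℝ => x + t • v).tendsto' 0 x (by simp)).mono_left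
        nhdsWithin_le_nhds
    refine ge_of_tendsto (hf.hasLineDerivAt v).tendsto_slope_zero_right ?_
    filter_upwards [self_mem_nhdsWithin, hline.eventually hle] with t (ht : 0 < t) hz
    rw [dist_self_add_right, norm_smul, Real.norm_of_nonneg ht.le] at hz
    rw [smul_eq_mul, inv_mul_eq_div, le_div_iff₀ ht]
    linarith
  refine f'.opNorm_le_bound hm fun v => abs_le.2 ⟨hdir v, ?_⟩
  have := hdir (-v)
  rw [norm_neg, map_neg] at this
  linarith

section PolyakLojasiewicz

variable {E : Type*} [NormedAddCommGroup E] [InnerProductSpace ℝ E] [CompleteSpace E]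
  {f : E → ℝ} {xs x y : E} {μ m : ℝ}

/-- The differentiable function `f` on a Hilbert space satisfies the Polyak-Łojasiewicz inequality
with constant `μ > 0`, and `xs` is its unique minimizer. Regularity of the gradient is left out, as
quadratic growth does not depend on it. -/
structure IsPLMinimizer (f : E → ℝ) (xs : E) (μ : ℝ) : Prop where
  differentiable : Differentiable ℝ f
  isMin : ∀ x, f xs ≤ f x
  unique_min : ∀ y, (∀ x, f y ≤ f x) → y = xs
  mu_pos : 0 < μ
  pl : ∀ x, μ * (f x - f xs) ≤ 1 / 2 * ‖∇ f x‖ ^ 2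

namespace IsPLMinimizer

lemma sub_nonneg (hf : IsPLMinimizer f xs μ) (x : E) : 0 ≤ f x - f xs :=
  _root_.sub_nonneg.2 (hf.isMin x)

lemma two_mul_mul_sub_le (hf : IsPLMinimizer f xs μ) (x : E) :
    2 * μ * (f x - f xs) ≤ ‖∇ f x‖ ^ 2 := by
  linarith [hf.pl x]

lemma eq_of_forall_sqrt_le_add (hf : IsPLMinimizer f xs μ) (hm : 0 ≤ m) (hmμ : m < √(μ / 2))
    (hy : ∀ z, √(f y - f xs) ≤ √(f z - f xs) + m * dist y z) : y = xs := by
  by_contra hne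
  have hV : 0 < f y - f xs := (hf.sub_nonneg y).lt_of_ne fun h0 =>
    hne (hf.unique_min y fun x => by linarith [hf.isMin x])
  have hderiv := ((hf.differentiable y).hasGradientAt.hasFDerivAt.sub_const (f xs)).sqrt hV.ne'
  have hslope := norm_fderiv_le_of_eventually_le_add hderiv hm (Eventually.of_forall hy)
  rw [norm_smul, LinearIsometryEquiv.norm_map, Real.norm_of_nonneg (by positivity), one_div,
    inv_mul_le_iff₀ (by positivity)] at hslope
  have hgrad : ‖∇ f y‖ ^ 2 ≤ 4 * m ^ 2 * (f y - f xs) := by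
    calc ‖∇ f y‖ ^ 2 ≤ (2 * √(f y - f xs) * m) ^ 2 := by gcongr
      _ = 4 * m ^ 2 * √(f y - f xs) ^ 2 := by ring
      _ = 4 * m ^ 2 * (f y - f xs) := by rw [sq_sqrt hV.le]
  have hm_sq : m ^ 2 < μ / 2 := (lt_sqrt hm).1 hmμ
  nlinarith [hf.two_mul_mul_sub_le y]

theorem sqrt_mul_norm_sub_le (hf : IsPLMinimizer f xs μ) (x : E) :
    √(μ / 2) * ‖x - xs‖ ≤ √(f x - f xs) := by
  have hμ : 0 < √(μ / 2) := sqrt_pos.2 (half_pos hf.mu_pos)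
  have hcont : Continuous fun z => √(f z - f xs) :=
    (hf.differentiable.continuous.sub continuous_const).sqrt
  have hbdd : BddBelow (range fun z => √(f z - f xs)) :=
    ⟨0, forall_mem_range.2 fun _ => sqrt_nonneg _⟩
  have hle (m : ℝ) (hm : m ∈ Ioo 0 √(μ / 2)) : m * ‖x - xs‖ ≤ √(f x - f xs) := by
    obtain ⟨y, hxy, hy⟩ :=
      exists_forall_le_add_mul_dist hm.1 hcont.lowerSemicontinuous hbdd x
    obtain rfl := hf.eq_of_forall_sqrt_le_add hm.1.le hm.2 hy
    simpa [dist_eq_norm] using hxy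
  exact le_of_tendsto ((continuous_mul_const ‖x - xs‖).tendsto _ |>.mono_left nhdsWithin_le_nhds)
    (eventually_of_mem (Ioo_mem_nhdsLT hμ) hle)

lemma norm_sub_le (hf : IsPLMinimizer f xs μ) (x : E) :
    ‖x - xs‖ ≤ 1 / √(μ / 2) * √(f x - f xs) := by
  rw [one_div, le_inv_mul_iff₀ (sqrt_pos.2 (half_pos hf.mu_pos))]
  exact hf.sqrt_mul_norm_sub_le x

lemma exists_forall_norm_sub_le (hf : IsPLMinimizer f xs μ) {ε : ℝ} (hε : 0 < ε) :
    ∃ r, 0 < r ∧ ∀ x, f x - f xs ≤ r → ‖x - xs‖ ≤ ε := by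
  have hμ : 0 < √(μ / 2) := sqrt_pos.2 (half_pos hf.mu_pos)
  refine ⟨(√(μ / 2) * ε) ^ 2, by positivity, fun x hx => ?_⟩
  refine le_of_mul_le_mul_left ?_ hμ
  exact (hf.sqrt_mul_norm_sub_le x).trans (sqrt_le_iff.2 ⟨by positivity, hx⟩)

end IsPLMinimizer

end PolyakLojasiewicz

section ScalarDecay

variable {p q ξ V V' : ℝ}

/-- The rate `ρ` of the scalar fixed-time decay law `V' = -ρ V`. With `ξ / 2` in place of `ξ` it is
also the speed of the flow as a function of `‖∇ f‖`. -/
noncomputable def decayRate (p q ξ V : ℝ) : ℝ := p * V ^ (1 - 1 / ξ) + q * V ^ (1 + 1 / ξ)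

lemma decayRate_nonneg (hp : 0 ≤ p) (hq : 0 ≤ q) (hV : 0 ≤ V) : 0 ≤ decayRate p q ξ V := by
  unfold decayRate; positivity

lemma decayRate_pos (hp : 0 < p) (hq : 0 < q) (hV : 0 < V) : 0 < decayRate p q ξ V := by
  unfold decayRate; positivity

lemma monotoneOn_decayRate (hp : 0 ≤ p) (hq : 0 ≤ q) (hξ : 1 ≤ ξ) :
    MonotoneOn (decayRate p q ξ) (Ici 0) := by
  intro V (hV : 0 ≤ V) V' _ hVV'
  have hexp : 0 ≤ 1 - 1 / ξ := sub_nonneg.2 ((div_le_one (by linarith)).2 hξ)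
  unfold decayRate
  gcongr

lemma mul_decayRate_half (hV : 0 < V) : V * decayRate p q (ξ / 2) V = decayRate p q ξ (V ^ 2) := by
  have hexp : 1 / (ξ / 2) = 2 * (1 / ξ) := by rw [one_div_div]; ring
  have hpow (s : ℝ) : V * V ^ (1 + 2 * s) = (V ^ 2) ^ (1 + s) := by
    rw [← rpow_two, ← rpow_mul hV.le, mul_comm, ← rpow_add_one hV.ne']
    congr 1; ring
  have hlow := hpow (-(1 / ξ))
  have hhigh := hpow (1 / ξ)
  rw [mul_neg, ← sub_eq_add_neg, ← sub_eq_add_neg] at hlow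
  simp only [decayRate, hexp, ← hlow, ← hhigh]
  ring

lemma decayRate_mul {a : ℝ} (ha : 0 ≤ a) (hV : 0 ≤ V) :
    decayRate p q ξ (a * V) =
      decayRate (p * a ^ (1 - 1 / ξ)) (q * a ^ (1 + 1 / ξ)) ξ V := by
  simp only [decayRate, mul_rpow ha hV, mul_assoc]

/-- The variable in which the decay law `V' = -decayRate p q ξ V` becomes motion with constant
speed `√(p q) / ξ`. -/
noncomputable def decayPhase (p q ξ V : ℝ) : ℝ := arctan (√(q / p) * V ^ (1 / ξ))

lemma decayPhase_lt_pi_div_two : decayPhase p q ξ V < π / 2 := arctan_lt_pi_div_two _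

lemma decayPhase_nonneg (hV : 0 ≤ V) : 0 ≤ decayPhase p q ξ V := by
  rw [decayPhase, arctan_nonneg]; positivity

lemma decayPhase_pos (hp : 0 < p) (hq : 0 < q) (hV : 0 < V) : 0 < decayPhase p q ξ V := by
  rw [decayPhase, arctan_pos]; positivity

lemma monotoneOn_decayPhase (hξ : 0 ≤ ξ) : MonotoneOn (decayPhase p q ξ) (Ici 0) := by
  intro V (hV : 0 ≤ V) V' _ hVV'
  exact arctan_strictMono.monotone (by gcongr)

lemma continuous_decayPhase (hξ : 0 ≤ ξ) : Continuous (decayPhase p q ξ) :=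
  continuous_arctan.comp ((continuous_rpow_const (by positivity)).const_mul _)

lemma sqrt_mul_eq_mul_sqrt_div (hp : 0 < p) (q : ℝ) : √(p * q) = p * √(q / p) := by
  rw [← sqrt_sq hp.le, ← sqrt_mul (sq_nonneg p), sqrt_sq hp.le]
  congr 1
  field_simp

lemma hasDerivAt_decayPhase (hp : 0 < p) (hq : 0 < q) (hV : 0 < V) :
    HasDerivAt (decayPhase p q ξ) (√(p * q) / ξ / decayRate p q ξ V) V := by
  have hrate := decayRate_pos (ξ := ξ) hp hq hV
  convert! ((hasDerivAt_rpow_const (p := 1 / ξ) (Or.inl hV.ne')).const_mul √(q / p)).arctan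
    using 1
  have hlow : V ^ (1 / ξ - 1) * V ^ (1 - 1 / ξ) = 1 := by
    rw [← rpow_add hV, sub_add_sub_cancel, sub_self, rpow_zero]
  have hhigh : V ^ (1 / ξ - 1) * V ^ (1 + 1 / ξ) = (V ^ (1 / ξ)) ^ 2 := by
    rw [← rpow_add hV, sq, ← rpow_add hV]; ring_nf
  have hmul : V ^ (1 / ξ - 1) * decayRate p q ξ V = p * (1 + (√(q / p) * V ^ (1 / ξ)) ^ 2) := by
    calc V ^ (1 / ξ - 1) * decayRate p q ξ V
        = p * (V ^ (1 / ξ - 1) * V ^ (1 - 1 / ξ)) + q * (V ^ (1 / ξ - 1) * V ^ (1 + 1 / ξ)) := by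
          rw [decayRate]; ring
      _ = p * (1 + q / p * (V ^ (1 / ξ)) ^ 2) := by rw [hlow, hhigh]; field_simp
      _ = p * (1 + (√(q / p) * V ^ (1 / ξ)) ^ 2) := by rw [mul_pow, sq_sqrt (by positivity)]
  have hden : 0 < 1 + (√(q / p) * V ^ (1 / ξ)) ^ 2 := by positivity
  rw [sqrt_mul_eq_mul_sqrt_div hp, one_div_mul_eq_div, eq_div_iff hden.ne', div_mul_eq_mul_div,
    div_eq_iff hrate.ne']
  linear_combination (-√(q / p) / ξ) * hmul

lemma decayPhase_le_sub (hp : 0 < p) (hq : 0 < q) (hξ : 1 ≤ ξ) (hV : 0 < V) (hV' : 0 ≤ V') {h : ℝ}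
    (hh : 0 ≤ h) (hstep : V' ≤ V - h * decayRate p q ξ V) :
    decayPhase p q ξ V' ≤ decayPhase p q ξ V - h * (√(p * q) / ξ) := by
  have hrate := decayRate_pos (ξ := ξ) hp hq hV
  have hξ₀ : 0 < ξ := by linarith
  have hle : V' ≤ V := hstep.trans (sub_le_self _ (by positivity))
  have hpos {u : ℝ} (hu : u ∈ interior (Icc V' V)) : 0 < u := by
    rw [interior_Icc] at hu
    exact hV'.trans_lt hu.1
  have hmvt : √(p * q) / ξ / decayRate p q ξ V * (V - V') ≤
      decayPhase p q ξ V - decayPhase p q ξ V' := by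
    refine (convex_Icc V' V).mul_sub_le_image_sub_of_le_deriv
      (continuous_decayPhase hξ₀.le).continuousOn
      (fun u hu => (hasDerivAt_decayPhase hp hq (hpos hu)).differentiableAt.differentiableWithinAt)
      (fun u hu => ?_) V' (left_mem_Icc.2 hle) V (right_mem_Icc.2 hle) hle
    rw [(hasDerivAt_decayPhase hp hq (hpos hu)).deriv]
    have hmono : decayRate p q ξ u ≤ decayRate p q ξ V :=
      monotoneOn_decayRate hp.le hq.le hξ (hpos hu).le hV.le (interior_subset hu).2
    have := decayRate_pos (ξ := ξ) hp hq (hpos hu)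
    gcongr
  have hspeed : h * (√(p * q) / ξ) ≤ √(p * q) / ξ / decayRate p q ξ V * (V - V') := by
    calc h * (√(p * q) / ξ)
        = √(p * q) / ξ / decayRate p q ξ V * (h * decayRate p q ξ V) := by field_simp
      _ ≤ √(p * q) / ξ / decayRate p q ξ V * (V - V') := by gcongr; linarith
  linarith

/-- The alternative below is an invariant: the second case persists until the sequence drops to `a`,
and from then on the first one holds. -/
lemma le_or_decayPhase_le_sub_mul {V : ℕ → ℝ} {a b C h : ℝ} (hp : 0 < p) (hq : 0 < q)
    (hξ : 1 ≤ ξ) (hh : 0 ≤ h) (ha : 0 ≤ a) (hbC : b ≤ C) (hV : ∀ k, 0 ≤ V k) (hV₀ : V 0 ≤ C)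
    (hsmall : ∀ k, V k ≤ a → V (k + 1) ≤ b)
    (hlarge : ∀ k, V k ≤ C → a < V k → V (k + 1) ≤ V k - h * decayRate p q ξ (V k)) (k : ℕ) :
    V k ≤ b ∨ V k ≤ C ∧ decayPhase p q ξ (V k) ≤ decayPhase p q ξ C - k * (h * (√(p * q) / ξ)) := by
  induction k with
  | zero =>
    refine Or.inr ⟨hV₀, ?_⟩
    simpa using monotoneOn_decayPhase (by linarith) (hV 0) ((hV 0).trans hV₀) hV₀
  | succ k ih =>
    rcases le_or_gt (V k) a with hk | hk
    · exact Or.inl (hsmall k hk)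
    have hstep := hlarge k (ih.elim hbC.trans' And.left) hk
    have hdec : V (k + 1) ≤ V k :=
      hstep.trans (sub_le_self _ (mul_nonneg hh (decayRate_nonneg hp.le hq.le (hV k))))
    refine ih.imp hdec.trans fun ⟨hkC, hphase⟩ => ⟨hdec.trans hkC, ?_⟩
    push_cast
    linarith [hphase, decayPhase_le_sub hp hq hξ (ha.trans_lt hk) (hV (k + 1)) hh hstep]

lemma rpow_le_of_decayPhase_le {t : ℝ} (hp : 0 < p) (hq : 0 < q) (hV : 0 ≤ V)
    (ht : 0 < √(p * q) / ξ * t)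
    (h : decayPhase p q ξ V ≤ π / 2 - √(p * q) / ξ * t) :
    V ^ (1 / ξ) ≤ √(p / q) * tan (π / 2 - √(p * q) / ξ * t) := by
  have hnonneg := (decayPhase_nonneg hV).trans h
  have htan : √(q / p) * V ^ (1 / ξ) ≤ tan (π / 2 - √(p * q) / ξ * t) := by
    rwa [← arctan_le_arctan_iff, arctan_tan (by linarith [pi_pos]) (by linarith)]
  have hcancel : √(p / q) * √(q / p) = 1 := by
    rw [← sqrt_mul (by positivity), div_mul_div_cancel₀ hq.ne', div_self hp.ne', sqrt_one]
  calc V ^ (1 / ξ) = √(p / q) * (√(q / p) * V ^ (1 / ξ)) := by rw [← mul_assoc, hcancel, one_mul]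
    _ ≤ √(p / q) * tan (π / 2 - √(p * q) / ξ * t) := by gcongr

lemma inv_sqrt_mul_sqrt_le_tanBound {m t : ℝ} (hp : 0 < p) (hq : 0 < q) (hξ : 0 < ξ) (hV : 0 ≤ V)
    (ht : 0 < t) (h : decayPhase p q ξ V ≤ π / 2 - √(p * q) / ξ * t) :
    1 / √m * √V ≤ tanBound m ξ p q t := by
  have hpow : √V = (V ^ (1 / ξ)) ^ (ξ / 2) := by
    rw [← rpow_mul hV, sqrt_eq_rpow]; congr 1; field_simp
  rw [tanBound, hpow]
  gcongr
  refine (rpow_le_of_decayPhase_le hp hq hV (by positivity) h).trans ?_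
  gcongr
  exact le_max_right _ _

lemma tanBound_nonneg {m t : ℝ} : 0 ≤ tanBound m ξ p q t := by
  unfold tanBound; positivity

lemma kStar_eq (ξ p q η : ℝ) : kStar ξ p q η = ⌈π / 2 / (√(p * q) / ξ * η)⌉₊ := by
  rw [kStar]; congr 1
  field_simp

lemma pi_div_two_le_of_kStar_le {η : ℝ} (hp : 0 < p) (hq : 0 < q) (hξ : 0 < ξ) (hη : 0 < η) {k : ℕ}
    (hk : kStar ξ p q η ≤ k) : π / 2 ≤ √(p * q) / ξ * (η * k) := by
  rw [kStar_eq, Nat.ceil_le, div_le_iff₀ (by positivity)] at hk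
  linarith

lemma lt_of_le_kStar {η : ℝ} (hp : 0 < p) (hq : 0 < q) (hξ : 0 < ξ) (hη : 0 < η) {k : ℕ}
    (hk : k ≤ kStar ξ p q η) : √(p * q) / ξ * (η * k) < π / 2 + √(p * q) / ξ * η := by
  have hω : 0 < √(p * q) / ξ * η := by positivity
  have hlt : (k : ℝ) < π / 2 / (√(p * q) / ξ * η) + 1 := by
    rw [kStar_eq] at hk
    exact (Nat.cast_le.2 hk).trans_lt (Nat.ceil_lt_add_one (by positivity))
  rw [← sub_lt_iff_lt_add, lt_div_iff₀ hω] at hlt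
  linarith

/-- The total phase travelled up to time `k*` is at most `3`, so slowing the motion by a factor
`1 - δ` costs at most `3 δ`. -/
lemma le_kStar_and_le_sub_of_slack {η δ θ θ₀ : ℝ} {k : ℕ} (hp : 0 < p) (hq : 0 < q) (hξ : 0 < ξ)
    (hη : 0 < η) (hηω : √(p * q) / ξ * η ≤ 1) (hδ : 0 < δ) (hδ₁ : δ ≤ 1)
    (hslack : 3 * δ ≤ π / 2 - θ₀) (hθ : 0 < θ)
    (h : θ ≤ θ₀ - k * ((1 - δ) * η * (√(p * q) / ξ))) :
    k ≤ kStar ξ p q η ∧ θ ≤ π / 2 - √(p * q) / ξ * (η * k) := by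
  have hslow : θ ≤ θ₀ - (1 - δ) * (√(p * q) / ξ * (η * k)) := h.trans_eq (by ring)
  have hk : k ≤ kStar ξ p q η := by
    by_contra! hlt
    have htime := pi_div_two_le_of_kStar_le hp hq hξ hη hlt.le
    have : (1 - δ) * (π / 2) ≤ (1 - δ) * (√(p * q) / ξ * (η * k)) := by gcongr
    nlinarith [hslow, pi_lt_four]
  refine ⟨hk, ?_⟩
  have htime : √(p * q) / ξ * (η * k) ≤ 3 := by
    linarith [lt_of_le_kStar hp hq hξ hη hk, pi_le_four]
  have : δ * (√(p * q) / ξ * (η * k)) ≤ δ * 3 := by gcongr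
  linarith [hslow]

lemma le_or_le_kStar_and_decayPhase_le_sub {V : ℕ → ℝ} {a b C η δ : ℝ} (hp : 0 < p) (hq : 0 < q)
    (hξ : 1 ≤ ξ) (hη : 0 < η) (hηω : √(p * q) / ξ * η ≤ 1) (hδ : 0 < δ) (hδ₁ : δ ≤ 1)
    (hslack : 3 * δ ≤ π / 2 - decayPhase p q ξ C) (ha : 0 ≤ a) (hb : 0 ≤ b) (hbC : b ≤ C)
    (hV : ∀ k, 0 ≤ V k) (hV₀ : V 0 ≤ C) (hsmall : ∀ k, V k ≤ a → V (k + 1) ≤ b)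
    (hlarge : ∀ k, V k ≤ C → a < V k → V (k + 1) ≤ V k - (1 - δ) * η * decayRate p q ξ (V k))
    (k : ℕ) : V k ≤ b ∨
      k ≤ kStar ξ p q η ∧ decayPhase p q ξ (V k) ≤ π / 2 - √(p * q) / ξ * (η * k) := by
  refine or_iff_not_imp_left.2 fun hkb => ?_
  have hphase := (le_or_decayPhase_le_sub_mul hp hq hξ (mul_nonneg (sub_nonneg.2 hδ₁) hη.le) ha
    hbC hV hV₀ hsmall hlarge k).resolve_left hkb
  exact le_kStar_and_le_sub_of_slack hp hq (by linarith) hη hηω hδ hδ₁ hslack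
    (decayPhase_pos hp hq (hb.trans_lt (not_le.1 hkb))) hphase.2

end ScalarDecay

section EulerStep

variable {E : Type*} [NormedAddCommGroup E] [InnerProductSpace ℝ E] [CompleteSpace E]
  {f : E → ℝ} {xs x : E} {μ c₁ c₂ ξ : ℝ} {ρ : ℝ → ℝ}

theorem le_add_inner_gradient_add_sq {s : Set E} {L : ℝ≥0} {v : E} (hs : Convex ℝ s)
    (hf : ∀ y ∈ s, DifferentiableAt ℝ f y) (hL : LipschitzOnWith L (∇ f) s) (hx : x ∈ s)
    (hv : x + v ∈ s) : f (x + v) ≤ f x + inner ℝ (∇ f x) v + L / 2 * ‖v‖ ^ 2 := by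
  have hseg {t : ℝ} (ht : t ∈ Icc (0 : ℝ) 1) : x + t • v ∈ s := by
    simpa using hs.add_smul_sub_mem hx hv ht
  let defect : ℝ → ℝ := fun t => f (x + t • v) - t * inner ℝ (∇ f x) v - t ^ 2 * (L / 2 * ‖v‖ ^ 2)
  have hderiv {t : ℝ} (ht : t ∈ Icc (0 : ℝ) 1) : HasDerivAt defect
      (inner ℝ (∇ f (x + t • v)) v - inner ℝ (∇ f x) v - 2 * t * (L / 2 * ‖v‖ ^ 2)) t := by
    have hline : HasDerivAt (fun t : ℝ => x + t • v) v t := by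
      simpa using ((hasDerivAt_id t).smul_const v).const_add x
    have hgrad := (hf _ (hseg ht)).hasGradientAt.hasFDerivAt
    have hf' : HasDerivAt (fun t => f (x + t • v)) (inner ℝ (∇ f (x + t • v)) v) t :=
      (hgrad.comp_hasDerivAt t hline :)
    refine ((hf'.sub ((hasDerivAt_id t).mul_const _)).sub
      ((hasDerivAt_pow 2 t).mul_const (L / 2 * ‖v‖ ^ 2))).congr_deriv ?_
    simp only [one_mul, Nat.cast_ofNat, Nat.add_one_sub_one, pow_one]
  have hanti : AntitoneOn defect (Icc 0 1) := by
    refine antitoneOn_of_deriv_nonpos (convex_Icc 0 1)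
      (fun t ht => (hderiv ht).continuousAt.continuousWithinAt)
      (fun t ht => (hderiv (interior_subset ht)).differentiableAt.differentiableWithinAt)
      fun t ht => ?_
    have ht := interior_subset ht
    rw [(hderiv ht).deriv, ← inner_sub_left]
    have hlip : ‖∇ f (x + t • v) - ∇ f x‖ ≤ L * (t * ‖v‖) := by
      simpa [norm_smul, abs_of_nonneg ht.1] using hL.norm_sub_le (hseg ht) hx
    calc inner ℝ (∇ f (x + t • v) - ∇ f x) v - 2 * t * (L / 2 * ‖v‖ ^ 2)
        ≤ L * (t * ‖v‖) * ‖v‖ - 2 * t * (L / 2 * ‖v‖ ^ 2) := by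
          gcongr
          exact (real_inner_le_norm _ _).trans (by gcongr)
      _ = 0 := by ring
  have := hanti (left_mem_Icc.2 zero_le_one) (right_mem_Icc.2 zero_le_one) zero_le_one
  simp only [defect, one_smul, zero_smul, add_zero, one_mul, zero_mul, one_pow, ne_eq,
    OfNat.ofNat_ne_zero, not_false_eq_true, zero_pow, sub_zero] at this
  linarith

/-- The field pointing along `-∇ f` with speed `ρ ‖∇ f‖`, which generalizes the fixed-time stable
gradient flow. It is `0` at critical points, whatever `ρ 0` is. -/
noncomputable def steepestDescentField (ρ : ℝ → ℝ) (f : E → ℝ) (x : E) : E :=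
  -(ρ ‖∇ f x‖ / ‖∇ f x‖) • ∇ f x

lemma norm_steepestDescentField_le (hρ : 0 ≤ ρ ‖∇ f x‖) :
    ‖steepestDescentField ρ f x‖ ≤ ρ ‖∇ f x‖ := by
  rw [steepestDescentField, norm_smul, norm_neg, Real.norm_of_nonneg (by positivity)]
  exact mul_le_of_le_div₀ hρ (norm_nonneg _) le_rfl

lemma inner_gradient_steepestDescentField :
    inner ℝ (∇ f x) (steepestDescentField ρ f x) = -(‖∇ f x‖ * ρ ‖∇ f x‖) := by
  rcases eq_or_ne (∇ f x) 0 with h0 | h0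
  · simp [h0]
  · have := norm_ne_zero_iff.2 h0
    rw [steepestDescentField, inner_smul_right, real_inner_self_eq_norm_sq]
    field_simp

lemma apply_add_smul_steepestDescentField_le {L η : ℝ} (hL : 0 ≤ L) (hη : 0 ≤ η)
    (hρ : 0 ≤ ρ ‖∇ f x‖) (hshort : η * ρ ‖∇ f x‖ ≤ 1)
    (hdesc : ∀ v : E, ‖v‖ ≤ 1 → f (x + v) ≤ f x + inner ℝ (∇ f x) v + L / 2 * ‖v‖ ^ 2) :
    f (x + η • steepestDescentField ρ f x) ≤
      f x - η * (‖∇ f x‖ * ρ ‖∇ f x‖) + L / 2 * (η * ρ ‖∇ f x‖) ^ 2 := by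
  have hnorm : ‖η • steepestDescentField ρ f x‖ ≤ η * ρ ‖∇ f x‖ := by
    rw [norm_smul, Real.norm_of_nonneg hη]
    gcongr
    exact norm_steepestDescentField_le hρ
  refine (hdesc _ (hnorm.trans hshort)).trans ?_
  rw [inner_smul_right, inner_gradient_steepestDescentField, mul_neg, ← sub_eq_add_neg]
  gcongr

lemma eventually_mul_le_nhdsGT_zero (K : ℝ) {r : ℝ} (hr : 0 < r) :
    ∀ᶠ η in 𝓝[>] (0 : ℝ), η * K ≤ r :=
  ((continuous_mul_const K).tendsto' 0 0 (zero_mul K)).mono_left nhdsWithin_le_nhds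
    |>.eventually_le_const hr

namespace IsPLMinimizer

/-- Quadratic growth makes sublevel sets bounded. -/
lemma exists_descent_on_sublevel (hf : IsPLMinimizer f xs μ)
    (hLip : ∀ r, ∃ L : ℝ≥0, LipschitzOnWith L (∇ f) (closedBall xs r)) (C : ℝ) :
    ∃ L G : ℝ, 0 ≤ L ∧ ∀ x, f x - f xs ≤ C → ‖∇ f x‖ ≤ G ∧
      ∀ v : E, ‖v‖ ≤ 1 → f (x + v) ≤ f x + inner ℝ (∇ f x) v + L / 2 * ‖v‖ ^ 2 := by
  let R := 1 / √(μ / 2) * √C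
  have hR : 0 ≤ R := by positivity
  obtain ⟨L, hL⟩ := hLip (R + 1)
  refine ⟨L, ‖∇ f xs‖ + L * R, L.coe_nonneg, fun x hx => ?_⟩
  have hxR : ‖x - xs‖ ≤ R := (hf.norm_sub_le x).trans (by dsimp only [R]; gcongr)
  have hmem : x ∈ closedBall xs (R + 1) := mem_closedBall_iff_norm.2 (by linarith)
  have hcenter : xs ∈ closedBall xs (R + 1) := mem_closedBall_self (by linarith [hR])
  refine ⟨?_, fun v hv => ?_⟩
  · calc ‖∇ f x‖ ≤ ‖∇ f xs‖ + ‖∇ f x - ∇ f xs‖ := norm_le_norm_add_norm_sub' _ _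
      _ ≤ ‖∇ f xs‖ + L * R := by
        gcongr
        exact (hL.norm_sub_le hmem hcenter).trans (by gcongr)
  · refine le_add_inner_gradient_add_sq (convex_closedBall xs (R + 1))
      (fun y _ => hf.differentiable y) hL hmem (mem_closedBall_iff_norm.2 ?_)
    rw [add_sub_right_comm]
    exact (norm_add_le _ _).trans (add_le_add hxR hv)

lemma eventually_steepestDescent_step (hf : IsPLMinimizer f xs μ)
    (hLip : ∀ r, ∃ L : ℝ≥0, LipschitzOnWith L (∇ f) (closedBall xs r))
    (hρ : ∀ g, 0 ≤ g → 0 ≤ ρ g) (hρ_mono : MonotoneOn ρ (Ici 0)) (C : ℝ) {r d δ : ℝ}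
    (hr : 0 < r) (hd : 0 < d) (hδ : 0 < δ) :
    ∀ᶠ η in 𝓝[>] (0 : ℝ), ∀ x, f x - f xs ≤ C →
      f (x + η • steepestDescentField ρ f x) ≤ f x + r ∧
      (d ≤ ‖∇ f x‖ → f (x + η • steepestDescentField ρ f x) ≤
        f x - (1 - δ) * η * (‖∇ f x‖ * ρ ‖∇ f x‖)) := by
  obtain ⟨L, G, hL, hdesc⟩ := hf.exists_descent_on_sublevel hLip C
  filter_upwards [self_mem_nhdsWithin, eventually_mul_le_nhdsGT_zero (ρ G) one_pos,
    eventually_mul_le_nhdsGT_zero (L / 2 * ρ G) hr,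
    eventually_mul_le_nhdsGT_zero (L / 2 * ρ G) (mul_pos hδ hd)]
    with η (hη : 0 < η) hshort hsmall hlarge x hx
  obtain ⟨hgG, hdesc⟩ := hdesc x hx
  have hg := hρ _ (norm_nonneg (∇ f x))
  have hspeed : ρ ‖∇ f x‖ ≤ ρ G :=
    hρ_mono (norm_nonneg _) ((norm_nonneg _).trans hgG) hgG
  have hshort' : η * ρ ‖∇ f x‖ ≤ 1 := hshort.trans' (by gcongr)
  have hstep := apply_add_smul_steepestDescentField_le hL hη.le hg hshort' hdesc
  have hquad : L / 2 * (η * ρ ‖∇ f x‖) ^ 2 ≤ η * (L / 2 * ρ G) * (η * ρ ‖∇ f x‖) := by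
    calc L / 2 * (η * ρ ‖∇ f x‖) ^ 2 = η * (L / 2 * ρ ‖∇ f x‖) * (η * ρ ‖∇ f x‖) := by ring
      _ ≤ η * (L / 2 * ρ G) * (η * ρ ‖∇ f x‖) := by gcongr
  refine ⟨?_, fun hdg => ?_⟩
  · have hgain : 0 ≤ η * (‖∇ f x‖ * ρ ‖∇ f x‖) := by positivity
    have hloss : η * (L / 2 * ρ G) * (η * ρ ‖∇ f x‖) ≤ r * 1 :=
      mul_le_mul hsmall hshort' (by positivity) hr.le
    linarith
  · have hloss : η * (L / 2 * ρ G) * (η * ρ ‖∇ f x‖) ≤ δ * ‖∇ f x‖ * (η * ρ ‖∇ f x‖) := by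
      refine mul_le_mul_of_nonneg_right (hlarge.trans ?_) (mul_nonneg hη.le hg)
      gcongr
    linarith

lemma decayRate_le (hf : IsPLMinimizer f xs μ) (hc₁ : 0 ≤ c₁) (hc₂ : 0 ≤ c₂) (hξ : 1 ≤ ξ)
    (hx : ∇ f x ≠ 0) :
    decayRate (c₁ * (2 * μ) ^ (1 - 1 / ξ)) (c₂ * (2 * μ) ^ (1 + 1 / ξ)) ξ (f x - f xs) ≤
      ‖∇ f x‖ * decayRate c₁ c₂ (ξ / 2) ‖∇ f x‖ := by
  have hμ : 0 ≤ 2 * μ := by linarith [hf.mu_pos]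
  rw [← decayRate_mul hμ (hf.sub_nonneg x), mul_decayRate_half (norm_pos_iff.2 hx)]
  exact monotoneOn_decayRate hc₁ hc₂ hξ (mul_nonneg hμ (hf.sub_nonneg x)) (sq_nonneg ‖∇ f x‖)
    (hf.two_mul_mul_sub_le x)

lemma eventually_euler_step (hf : IsPLMinimizer f xs μ)
    (hLip : ∀ r, ∃ L : ℝ≥0, LipschitzOnWith L (∇ f) (closedBall xs r)) (hc₁ : 0 ≤ c₁)
    (hc₂ : 0 ≤ c₂) (hξ : 2 ≤ ξ) (C : ℝ) {r δ : ℝ} (hr : 0 < r) (hδ : 0 < δ) (hδ₁ : δ ≤ 1) :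
    ∀ᶠ η in 𝓝[>] (0 : ℝ), ∀ x y, f x - f xs ≤ C →
      y = x + η • steepestDescentField (decayRate c₁ c₂ (ξ / 2)) f x →
      (f y - f xs ≤ f x - f xs + r) ∧
      (r < f x - f xs → f y - f xs ≤ f x - f xs - (1 - δ) * η *
        decayRate (c₁ * (2 * μ) ^ (1 - 1 / ξ)) (c₂ * (2 * μ) ^ (1 + 1 / ξ)) ξ (f x - f xs)) := by
  have hμ := hf.mu_pos
  have hd : 0 < √(2 * μ * r) := by positivity
  filter_upwards [self_mem_nhdsWithin, hf.eventually_steepestDescent_step hLip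
    (fun _ => decayRate_nonneg hc₁ hc₂) (monotoneOn_decayRate hc₁ hc₂ (ξ := ξ / 2) (by linarith))
    C hr hd hδ] with η (hη : 0 < η) hstep x y hx hy
  subst hy
  obtain ⟨hsmall, hlarge⟩ := hstep x hx
  refine ⟨by linarith, fun hrx => ?_⟩
  have hgrad : √(2 * μ * r) ≤ ‖∇ f x‖ :=
    sqrt_le_iff.2 ⟨norm_nonneg _, (hf.two_mul_mul_sub_le x).trans' (by gcongr)⟩
  have hrate := hf.decayRate_le hc₁ hc₂ (by linarith : 1 ≤ ξ)
    (norm_pos_iff.1 (hd.trans_le hgrad))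
  have := mul_le_mul_of_nonneg_left hrate (mul_nonneg (_root_.sub_nonneg.2 hδ₁) hη.le)
  linarith [hlarge hgrad]

end IsPLMinimizer

end EulerStep

theorem theorem4_general {E : Type*} [NormedAddCommGroup E] [InnerProductSpace ℝ E]
    [CompleteSpace E] {f : E → ℝ} {xs : E} {μ c₁ c₂ p q ξ : ℝ} (hf : IsPLMinimizer f xs μ)
    (hLip : ∀ r, ∃ L : ℝ≥0, LipschitzOnWith L (∇ f) (closedBall xs r)) (hc₁ : 0 < c₁)
    (hc₂ : 0 < c₂) (hξ : 2 ≤ ξ) (hp : p = c₁ * (2 * μ) ^ (1 - 1 / ξ))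
    (hq : q = c₂ * (2 * μ) ^ (1 + 1 / ξ)) (C : ℝ) {ε : ℝ} (hε : 0 < ε) :
    ∀ᶠ η in 𝓝[>] (0 : ℝ), ∀ x : ℕ → E, f (x 0) - f xs ≤ C →
      (∀ k, x (k + 1) = x k + η • steepestDescentField (decayRate c₁ c₂ (ξ / 2)) f (x k)) →
        (∀ k : ℕ, 0 < k → k ≤ kStar ξ p q η → ‖x k - xs‖ ≤ tanBound (μ / 2) ξ p q (η * k) + ε) ∧
        ∀ k : ℕ, kStar ξ p q η < k → ‖x k - xs‖ ≤ ε := by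
  have hμ := hf.mu_pos
  have hp₀ : 0 < p := by rw [hp]; positivity
  have hq₀ : 0 < q := by rw [hq]; positivity
  have hξ₀ : 0 < ξ := by linarith
  obtain ⟨r, hr, hclose⟩ := hf.exists_forall_norm_sub_le hε
  have hphase : decayPhase p q ξ (max C r) < π / 2 := decayPhase_lt_pi_div_two
  obtain ⟨δ, hδ, hδ'⟩ : ∃ δ, 0 < δ ∧ δ < min 1 ((π / 2 - decayPhase p q ξ (max C r)) / 3) :=
    exists_between (lt_min one_pos (by linarith))
  obtain ⟨hδ₁, hslack⟩ := lt_min_iff.1 hδ'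
  filter_upwards [self_mem_nhdsWithin, hf.eventually_euler_step hLip hc₁.le hc₂.le hξ (max C r)
    (half_pos hr) hδ hδ₁.le, eventually_mul_le_nhdsGT_zero (√(p * q) / ξ) one_pos]
    with η (hη : 0 < η) hstep hηω x hx₀ hx
  rw [← hp, ← hq] at hstep
  have hdich (k : ℕ) : ‖x k - xs‖ ≤ ε ∨ k ≤ kStar ξ p q η ∧
      decayPhase p q ξ (f (x k) - f xs) ≤ π / 2 - √(p * q) / ξ * (η * k) := by
    refine (le_or_le_kStar_and_decayPhase_le_sub hp₀ hq₀ (by linarith) hη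
      (by rwa [mul_comm]) hδ hδ₁.le (by linarith) (half_pos hr).le hr.le (le_max_right C r)
      (fun k => hf.sub_nonneg (x k)) (hx₀.trans (le_max_left C r)) (fun k hk => ?_)
      (fun k hkC => (hstep _ _ hkC (hx k)).2) k).imp_left (hclose _)
    have hkC : f (x k) - f xs ≤ max C r := by linarith [le_max_right C r]
    linarith [(hstep _ _ hkC (hx k)).1]
  refine ⟨fun k hk _ => ?_, fun k hk => (hdich k).resolve_right fun h => hk.not_ge h.1⟩
  have hbound := tanBound_nonneg (m := μ / 2) (ξ := ξ) (p := p) (q := q) (t := η * k)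
  rcases hdich k with hclose | ⟨-, hfar⟩
  · linarith
  · have := inv_sqrt_mul_sqrt_le_tanBound (m := μ / 2) hp₀ hq₀ hξ₀ (hf.sub_nonneg (x k))
      (by positivity) hfar
    linarith [hf.norm_sub_le (x k)]

section Parameters

variable {n : ℕ} {f : EuclideanSpace ℝ (Fin n) → ℝ} {xs : EuclideanSpace ℝ (Fin n)}
  {μ c c₁ c₂ p₁ p₂ r s ξ : ℝ}

lemma PLFunction.isPLMinimizer (hf : PLFunction f xs μ) : IsPLMinimizer f xs μ :=
  ⟨hf.contDiff.differentiable one_ne_zero, hf.isMin, hf.unique_min, hf.mu_pos, hf.pl⟩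

lemma PLFunction.exists_lipschitzOnWith_closedBall (hf : PLFunction f xs μ) (r : ℝ) :
    ∃ L : ℝ≥0, LipschitzOnWith L (∇ f) (closedBall xs r) :=
  hf.locallyLipschitz_gradient.locallyLipschitzOn.exists_lipschitzOnWith_of_compact
    (isCompact_closedBall xs r)

lemma two_le_xiParam (hp₁ : 2 < p₁) : 2 ≤ xiParam p₁ := by
  rw [xiParam, le_div_iff₀ (by linarith)]
  linarith

lemma sub_two_div_sub_one_eq (hp₁ : 2 < p₁) : (p₁ - 2) / (p₁ - 1) = 2 * (1 / xiParam p₁) := by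
  have : p₁ - 1 ≠ 0 := by linarith
  have hden : 2 * p₁ - 2 = 2 * (p₁ - 1) := by ring
  rw [xiParam, one_div_div, hden]
  field_simp

lemma sub_two_div_sub_one_eq_neg (hp₁ : 2 < p₁) (hp₂ : 1 < p₂) (hp₂' : p₂ < 2)
    (hp : 2 + 1 / (p₁ - 2) = 1 / (2 - p₂)) : (p₂ - 2) / (p₂ - 1) = -((p₁ - 2) / (p₁ - 1)) := by
  have h₁ : p₁ - 2 ≠ 0 := by linarith
  have h₁' : p₁ - 1 ≠ 0 := by linarith
  have h₂ : p₂ - 1 ≠ 0 := by linarith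
  have h₂' : 2 - p₂ ≠ 0 := by linarith
  field_simp at hp ⊢
  linear_combination -hp

lemma decayCoeff_eq (hr : r ≠ 1) (hs : (r - 2) / (r - 1) = 2 * s) :
    decayCoeff μ c r = c * (2 * μ) ^ (1 - s) := by
  have : r - 1 ≠ 0 := sub_ne_zero.2 hr
  have hexp : r / (2 * (r - 1)) = 1 - s := by
    field_simp at hs ⊢
    linear_combination -hs
  rw [decayCoeff, hexp]

lemma fxtsField_eq_steepestDescentField (h₁ : (p₁ - 2) / (p₁ - 1) = 2 * (1 / ξ))
    (h₂ : (p₂ - 2) / (p₂ - 1) = -(2 * (1 / ξ))) :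
    fxtsField f c₁ c₂ p₁ p₂ = steepestDescentField (decayRate c₁ c₂ (ξ / 2)) f := by
  have hexp : 1 / (ξ / 2) = 2 * (1 / ξ) := by rw [one_div_div]; ring
  funext x
  rcases eq_or_ne (∇ f x) 0 with h0 | h0
  · simp [fxtsField, steepestDescentField, h0]
  · have hg : 0 < ‖∇ f x‖ := norm_pos_iff.2 h0
    have hspeed : decayRate c₁ c₂ (ξ / 2) ‖∇ f x‖ / ‖∇ f x‖ =
        c₁ / ‖∇ f x‖ ^ ((p₁ - 2) / (p₁ - 1)) + c₂ / ‖∇ f x‖ ^ ((p₂ - 2) / (p₂ - 1)) := by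
      rw [decayRate, hexp, h₁, h₂, rpow_sub hg, rpow_add hg, rpow_neg hg.le, rpow_one]
      field_simp
    rw [fxtsField, if_neg h0, steepestDescentField, hspeed, neg_add, ← sub_eq_add_neg, sub_smul]

end Parameters

theorem theorem4 {n : ℕ} (f : EuclideanSpace ℝ (Fin n) → ℝ) (xs : EuclideanSpace ℝ (Fin n))
    (μ c₁ c₂ p₁ p₂ : ℝ) (hf : PLFunction f xs μ) (hc₁ : 0 < c₁) (hc₂ : 0 < c₂)
    (hp₁ : 2 < p₁) (hp₂ : 1 < p₂) (hp₂' : p₂ < 2)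
    (hp : 2 + 1 / (p₁ - 2) = 1 / (2 - p₂))
    (x₀ : EuclideanSpace ℝ (Fin n)) (ε : ℝ) (hε : 0 < ε) :
    ∃ ηs : ℝ, 0 < ηs ∧ ∀ η : ℝ, 0 < η → η ≤ ηs →
      ∀ x : ℕ → EuclideanSpace ℝ (Fin n),
        IsEulerTrajectory (fxtsField f c₁ c₂ p₁ p₂) η x₀ x →
          (∀ k : ℕ, 0 < k →
            k ≤ kStar (xiParam p₁) (decayCoeff μ c₁ p₁) (decayCoeff μ c₂ p₂) η →
              ‖x k - xs‖ ≤ tanBound (μ / 2) (xiParam p₁) (decayCoeff μ c₁ p₁)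
                (decayCoeff μ c₂ p₂) (η * k) + ε) ∧
          (∀ k : ℕ, kStar (xiParam p₁) (decayCoeff μ c₁ p₁) (decayCoeff μ c₂ p₂) η < k →
              ‖x k - xs‖ ≤ ε) := by
  have he₁ := sub_two_div_sub_one_eq hp₁
  have he₂ : (p₂ - 2) / (p₂ - 1) = 2 * -(1 / xiParam p₁) := by
    rw [sub_two_div_sub_one_eq_neg hp₁ hp₂ hp₂' hp, he₁, mul_neg]
  have hq : decayCoeff μ c₂ p₂ = c₂ * (2 * μ) ^ (1 + 1 / xiParam p₁) := by
    rw [decayCoeff_eq hp₂.ne' he₂, sub_neg_eq_add]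
  obtain ⟨ηs, hηs, hsub⟩ := mem_nhdsGT_iff_exists_Ioc_subset.1 <|
    theorem4_general hf.isPLMinimizer hf.exists_lipschitzOnWith_closedBall hc₁ hc₂
      (two_le_xiParam hp₁) (decayCoeff_eq (by linarith) he₁) hq (f x₀ - f xs) hε
  refine ⟨ηs, hηs, fun η hη hηηs x hx => hsub ⟨hη, hηηs⟩ x (by rw [hx.1]) ?_⟩
  rw [← fxtsField_eq_steepestDescentField he₁ (by rw [he₂, mul_neg])]
  exact hx.2
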